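/- For $n\ge 0$ let $\mathcal{D}_n$ be the Dyck lattice of order $n$: the set of Dyck paths of semilength $n$ (paths from $(0,0)$ to $(2n,0)$ with steps $(1,1)$ and $(1,-1)$ that never go below the $x$-axis), partially ordered by $\gamma\le\gamma'$ if and only if $\gamma$ lies weakly below $\gamma'$. For a finite poset $\mathcal{P}$ and a positive integer $h$, let $sc_h(\mathcal{P})$ be the number of saturated chains $x_0<x_1<\cdots<x_h$ of length $h$ in $\mathcal{P}$ (each $x_{i+1}$ covers $x_i$), and let $i_h(\mathcal{P})=sc_h(\mathcal{P})/|\mathcal{P}|$ be the Hasse index of order $h$ of $\mathcal{P}$. The Hasse index of order $h$ of a sequence $(\mathcal{P}_n)_{n\ge 0}$ of finite posets is called asymptotically Boolean if $i_h(\mathcal{P}_n)\sim (n)_h/2^h$ as $n\to\infty$, where $(n)_h=n(n-1)\cdots(n-h+1)$; equivalently, if $i_h(\mathcal{P}_n)\sim n^h/2^h$. Proposition. The Hasse index of order 3 of the sequence $(\mathcal{D}_n)_{n\ge 0}$ of Dyck lattices is asymptotically Boolean; that is, as $n\to\infty$, $$i_3(\mathcal{D}_n)\sim\frac{(n)_3}{2^3}\qquad\text{and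 equivalently}\qquad i_3(\mathcal{D}_n)\sim\frac{n^3}{8}.$$ Moreover, $$sc_3(\mathcal{D}_n)\sim\frac{2^{2n-3}\,n^{3/2}}{\sqrt{\pi}}\qquad (n\to\infty).$$ -/

import Mathlib

open Filter Asymptotics

/-- The ordinate, after the first `i` steps, of the lattice path which starts at the origin and
follows the word `w`, where `U` is the step `(1, 1)` and `D` is the step `(1, -1)`. -/
def pathHeight (w : List DyckStep) (i : ℕ) : ℤ :=
  ((w.take i).count DyckStep.U : ℤ) - ((w.take i).count DyckStep.D : ℤ)

/-- A path of known length is determined by its heights. -/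
theorem pathHeight_injective : ∀ {v w : List DyckStep}, v.length = w.length →
    (∀ i, pathHeight v i = pathHeight w i) → v = w
  | [], [], _, _ => rfl
  | [], _ :: _, hl, _ => by simp at hl
  | _ :: _, [], hl, _ => by simp at hl
  | a :: v, b :: w, hl, h => by
    have hab : a = b := by
      have h1 := h 1
      cases a <;> cases b <;> simp [pathHeight] at h1 ⊢
    subst hab
    have hvw : v = w := by
      refine pathHeight_injective (by simpa using hl) fun i => ?_
      have h1 := h (i + 1)
      cases a <;> simp [pathHeight] at h1 ⊢ <;> omega
    rw [hvw]

/-- The underlying set of the Dyck lattice of order `n`: the Dyck paths of semilength `n`.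
(This is a fresh type because Mathlib puts an order other than containment on `DyckWord`.) -/
@[ext]
structure DyckLattice (n : ℕ) where
  /-- The word of steps of the path. -/
  word : DyckWord
  /-- The path has semilength `n`. -/
  semilength_eq : word.semilength = n

namespace DyckLattice

/-- The ordinate of the Dyck path `γ` at the abscissa `i`. -/
def height {n : ℕ} (γ : DyckLattice n) (i : ℕ) : ℤ := pathHeight γ.word.toList i

theorem height_injective {n : ℕ} {γ γ' : DyckLattice n}
    (h : ∀ i, γ.height i = γ'.height i) : γ = γ' := by
  apply DyckLattice.ext
  apply DyckWord.ext
  refine pathHeight_injective ?_ h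
  rw [← DyckWord.two_mul_semilength_eq_length, ← DyckWord.two_mul_semilength_eq_length,
    γ.semilength_eq, γ'.semilength_eq]

/-- The containment order: `γ ≤ γ'` when `γ` lies weakly below `γ'`. -/
instance (n : ℕ) : PartialOrder (DyckLattice n) where
  le γ γ' := ∀ i, γ.height i ≤ γ'.height i
  le_refl _ _ := le_rfl
  le_trans _ _ _ h h' i := (h i).trans (h' i)
  le_antisymm _ _ h h' := height_injective fun i => le_antisymm (h i) (h' i)

instance (n : ℕ) : Finite (DyckLattice n) :=
  Finite.of_injective
    (fun γ : DyckLattice n => (⟨γ.word, γ.semilength_eq⟩ : { p : DyckWord // p.semilength = n }))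
    fun _ _ h => DyckLattice.ext (Subtype.ext_iff.mp h)

end DyckLattice

/-- The saturated chains `x₀ < x₁ < ⋯ < x_h` of length `h` in `P`: each element covers the
one before it. -/
def SaturatedChain (h : ℕ) (P : Type*) [PartialOrder P] : Type _ :=
  { c : Fin (h + 1) → P // ∀ i : Fin h, c i.castSucc ⋖ c i.succ }

/-- The number `sc_h(P)` of saturated chains of length `h` of a finite poset `P`. -/
noncomputable def numSaturatedChains (h : ℕ) (P : Type*) [PartialOrder P] [Finite P] : ℕ :=
  Nat.card (SaturatedChain h P)

/-- The Hasse index of order `h` of a finite poset `P`: `i_h(P) = sc_h(P) / |P|`. -/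
noncomputable def hasseIndex (h : ℕ) (P : Type*) [PartialOrder P] [Finite P] : ℝ :=
  (numSaturatedChains h P : ℝ) / (Nat.card P : ℝ)

/-- The Hasse index of order `h` of the sequence `P 0, P 1, …` of finite posets is asymptotically
Boolean: `i_h(P n) ∼ (n)_h / 2 ^ h`, where `(n)_h` is the falling factorial. -/
def HasseIndexAsymptoticallyBoolean (h : ℕ) (P : ℕ → Type*) [∀ n, PartialOrder (P n)]
    [∀ n, Finite (P n)] : Prop :=
  (fun n : ℕ => hasseIndex h (P n)) ~[atTop]
    fun n : ℕ => (n.descFactorial h : ℝ) / (2 : ℝ) ^ h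

/-! Going up one cover in the containment order means turning one valley into a peak
(`covBy_iff_exists_flip`), so a path with `v` valleys has exactly `v` covers. A flip changes the
number of valleys by at most one. Hence the saturated 3-chains from a path number between
`v(v-1)(v-2)` and `v(v+1)(v+2)`. Peaks and valleys alternate, so this is `p³ + O(n²)`, with `p` the
number of peaks.

It remains to find the third moment of `p`. Deleting a marked peak is a bijection onto shorter paths
with one of `2n+1` marked positions (`sum_peaks_mul`), and it changes `p` by at most one. Three
rounds, with the Catalan recurrence, give the average of `p³` as `n³/8 + O(n²)`. Multiplying by the
asymptotics of `catalan n`, from Stirling's formula, gives the count of chains. -/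

/-! ### Heights and two-step factors of words -/

section Words

open DyckStep

/-- The ordinate added by a step. -/
def DyckStep.rise : DyckStep → ℤ
  | U => 1
  | D => -1

@[simp] theorem DyckStep.rise_U : U.rise = 1 := rfl

@[simp] theorem DyckStep.rise_D : D.rise = -1 := rfl

@[simp] theorem pathHeight_zero (w : List DyckStep) : pathHeight w 0 = 0 := by
  simp [pathHeight]

@[simp] theorem pathHeight_cons_succ (a : DyckStep) (w : List DyckStep) (i : ℕ) :
    pathHeight (a :: w) (i + 1) = a.rise + pathHeight w i := by
  cases a <;> simp [pathHeight] <;> omega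

theorem pathHeight_succ_of_getElem? {w : List DyckStep} {i : ℕ} {a : DyckStep}
    (h : w[i]? = some a) : pathHeight w (i + 1) = pathHeight w i + a.rise := by
  cases a <;> simp [pathHeight, List.take_add_one, h] <;> omega

theorem pathHeight_eq_of_length_le {w : List DyckStep} {i : ℕ} (h : w.length ≤ i) :
    pathHeight w i = (w.count U : ℤ) - w.count D := by
  rw [pathHeight, List.take_of_length_le h]

theorem sub_one_le_pathHeight_succ (w : List DyckStep) (i : ℕ) :
    pathHeight w i - 1 ≤ pathHeight w (i + 1) := by
  rcases h : w[i]? with _ | a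
  · simp [pathHeight, List.take_add_one, h]
  · rw [pathHeight_succ_of_getElem? h]
    cases a <;> simp
    omega

theorem pathHeight_succ_le_add_one (w : List DyckStep) (i : ℕ) :
    pathHeight w (i + 1) ≤ pathHeight w i + 1 := by
  rcases h : w[i]? with _ | a
  · simp [pathHeight, List.take_add_one, h]
  · rw [pathHeight_succ_of_getElem? h]
    cases a <;> simp

theorem even_pathHeight_add {w : List DyckStep} : ∀ {i : ℕ}, i ≤ w.length →
    Even (pathHeight w i + i)
  | 0, _ => by simp
  | i + 1, hi => by
    have h := even_pathHeight_add (w := w) (i := i) (by omega)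
    have hs := pathHeight_succ_of_getElem? (w := w) (i := i) (List.getElem?_eq_getElem (by omega))
    rw [hs]
    generalize w[i] = a
    rw [Int.even_iff] at h ⊢
    push_cast
    cases a <;> simp <;> omega

theorem pathHeight_flip (L R : List DyckStep) (i : ℕ) :
    pathHeight (L ++ U :: D :: R) i =
      pathHeight (L ++ D :: U :: R) i + if i = L.length + 1 then 2 else 0 := by
  induction L generalizing i with
  | nil =>
    match i with
    | 0 => simp
    | 1 => simp
    | i + 2 => simp
  | cons a L ih =>
    match i with
    | 0 => simp
    | i + 1 => simp [ih, add_assoc]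

theorem forall_nonneg_pathHeight_cons (h : ℤ) (a : DyckStep) (w : List DyckStep) :
    (∀ i, 0 ≤ h + pathHeight (a :: w) i) ↔ 0 ≤ h ∧ ∀ i, 0 ≤ h + a.rise + pathHeight w i := by
  constructor
  · intro H
    exact ⟨by simpa using H 0, fun i => by simpa [add_assoc] using H (i + 1)⟩
  · rintro ⟨h0, H⟩ (_ | i)
    · simpa using h0
    · simpa [add_assoc] using H i

/-- An inserted peak returns to its starting height and stays above it. The offset `h` is there for
the induction on `L`. -/
theorem forall_nonneg_pathHeight_insert (L R : List DyckStep) (h : ℤ) :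
    (∀ i, 0 ≤ h + pathHeight (L ++ U :: D :: R) i) ↔ ∀ i, 0 ≤ h + pathHeight (L ++ R) i := by
  induction L generalizing h with
  | nil =>
    simp only [List.nil_append, forall_nonneg_pathHeight_cons, rise_U, rise_D,
      add_neg_cancel_right]
    constructor
    · exact fun H => H.2.2
    · intro H
      have := H 0
      simp only [pathHeight_zero] at this
      exact ⟨by omega, by omega, H⟩
  | cons a L ih => simp only [List.cons_append, forall_nonneg_pathHeight_cons, ih]

/-- The positions of the consecutive pairs of steps `a b` in the word `w`. -/
def factorPositions (a b : DyckStep) (w : List DyckStep) : Finset ℕ :=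
  (Finset.range w.length).filter fun i => w[i]? = some a ∧ w[i + 1]? = some b

theorem mem_factorPositions {a b : DyckStep} {w : List DyckStep} {i : ℕ} :
    i ∈ factorPositions a b w ↔ w[i]? = some a ∧ w[i + 1]? = some b := by
  simp only [factorPositions, Finset.mem_filter, Finset.mem_range, and_iff_right_iff_imp]
  rintro ⟨h, -⟩
  exact (List.getElem?_eq_some_iff.mp h).1

theorem eq_take_append_of_mem_factorPositions {a b : DyckStep} {w : List DyckStep} {i : ℕ}
    (h : i ∈ factorPositions a b w) : w = w.take i ++ a :: b :: w.drop (i + 2) := by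
  obtain ⟨h1, h2⟩ := mem_factorPositions.mp h
  obtain ⟨l1, e1⟩ := List.getElem?_eq_some_iff.mp h1
  obtain ⟨l2, e2⟩ := List.getElem?_eq_some_iff.mp h2
  conv_lhs => rw [← List.take_append_drop i w, List.drop_eq_getElem_cons l1,
    List.drop_eq_getElem_cons l2, e1, e2]

/-- The number of consecutive pairs of steps `a b` in the word `w`. -/
def factorCount (a b : DyckStep) (w : List DyckStep) : ℕ := (factorPositions a b w).card

@[simp] theorem factorCount_nil (a b : DyckStep) : factorCount a b [] = 0 := rfl

theorem factorCount_cons (a b c : DyckStep) (w : List DyckStep) :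
    factorCount a b (c :: w) = factorCount a b w + if c = a ∧ w[0]? = some b then 1 else 0 := by
  simp only [factorCount, factorPositions, Finset.card_filter, List.length_cons,
    Finset.sum_range_succ', List.getElem?_cons_succ, List.getElem?_cons_zero, Option.some.injEq]

theorem factorCount_le_length (a b : DyckStep) (w : List DyckStep) :
    factorCount a b w ≤ w.length :=
  (Finset.card_filter_le _ _).trans (Finset.card_range _).le

/-- Peaks and valleys alternate, beginning with a peak or a valley according to the first step. -/
theorem peaks_valleys_cons (w : List DyckStep) :
    (factorCount D U (U :: w) ≤ factorCount U D (U :: w) ∧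
      factorCount U D (U :: w) ≤ factorCount D U (U :: w) + 1) ∧
    (factorCount U D (D :: w) ≤ factorCount D U (D :: w) ∧
      factorCount D U (D :: w) ≤ factorCount U D (D :: w) + 1) := by
  induction w with
  | nil => simp [factorCount_cons]
  | cons a w ih =>
    rw [factorCount_cons _ _ _ (a :: w), factorCount_cons _ _ _ (a :: w),
      factorCount_cons _ _ _ (a :: w), factorCount_cons _ _ _ (a :: w)]
    cases a <;> simp <;> omega

theorem valleys_le_peaks_add_one (w : List DyckStep) :
    factorCount D U w ≤ factorCount U D w + 1 := by
  rcases w with _ | ⟨_ | _, w⟩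
  · simp
  · have := peaks_valleys_cons w
    omega
  · have := peaks_valleys_cons w
    omega

theorem peaks_le_valleys_add_one (w : List DyckStep) :
    factorCount U D w ≤ factorCount D U w + 1 := by
  rcases w with _ | ⟨_ | _, w⟩
  · simp
  · have := peaks_valleys_cons w
    omega
  · have := peaks_valleys_cons w
    omega

/-- The flip destroys the middle valley and creates one on the left if `L` ends in `D` and one on
the right if `R` begins with `U`: a net change of -1, 0 or 1. -/
theorem valleys_flip (L R : List DyckStep) :
    factorCount D U (L ++ U :: D :: R) ≤ factorCount D U (L ++ D :: U :: R) + 1 ∧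
    factorCount D U (L ++ D :: U :: R) ≤ factorCount D U (L ++ U :: D :: R) + 1 := by
  induction L with
  | nil =>
    simp only [List.nil_append, factorCount_cons]
    split_ifs <;> simp_all
    omega
  | cons a L ih =>
    -- A single remaining letter touches the changed pair; with two or more, the leading factor is
    -- common to both words.
    match L, ih with
    | [], _ =>
      simp only [List.nil_append, List.cons_append, factorCount_cons]
      split_ifs <;> simp_all
      omega
    | b :: L, ih =>
      simp only [List.cons_append] at ih ⊢
      rw [factorCount_cons _ _ a, factorCount_cons _ _ a]
      simp only [List.getElem?_cons_zero]
      split_ifs <;> omega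

/-- One peak is created, and one is lost exactly when the insertion splits an existing peak. -/
theorem peaks_insert (L R : List DyckStep) :
    factorCount U D (L ++ R) ≤ factorCount U D (L ++ U :: D :: R) ∧
    factorCount U D (L ++ U :: D :: R) ≤ factorCount U D (L ++ R) + 1 := by
  induction L with
  | nil =>
    simp only [List.nil_append, factorCount_cons]
    split_ifs <;> simp_all
  | cons a L ih =>
    match L, ih with
    | [], _ =>
      simp only [List.nil_append, List.cons_append, factorCount_cons]
      split_ifs <;> simp_all
    | b :: L, ih =>
      simp only [List.cons_append] at ih ⊢
      rw [factorCount_cons _ _ a, factorCount_cons _ _ a]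
      simp only [List.getElem?_cons_zero]
      split_ifs <;> omega

end Words

/-! ### Dyck paths, covers and peak insertion -/

namespace DyckLattice

open DyckStep

variable {n : ℕ}

noncomputable instance (n : ℕ) : Fintype (DyckLattice n) := Fintype.ofFinite _

theorem card_eq_catalan (n : ℕ) : Fintype.card (DyckLattice n) = catalan n := by
  rw [← DyckWord.card_dyckWord_semilength_eq_catalan n]
  exact Fintype.card_congr
    { toFun := fun γ => ⟨γ.word, γ.semilength_eq⟩
      invFun := fun p => ⟨p.1, p.2⟩
      left_inv := fun _ => rfl
      right_inv := fun _ => rfl }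

theorem length_word (γ : DyckLattice n) : γ.word.toList.length = 2 * n := by
  rw [← DyckWord.two_mul_semilength_eq_length, γ.semilength_eq]

theorem height_nonneg (γ : DyckLattice n) (i : ℕ) : 0 ≤ γ.height i := by
  have := γ.word.count_D_le_count_U i
  simp only [height, pathHeight]
  omega

theorem height_eq_zero (γ : DyckLattice n) {i : ℕ} (h : 2 * n ≤ i) : γ.height i = 0 := by
  rw [height, pathHeight_eq_of_length_le (by rwa [length_word]), γ.word.count_U_eq_count_D,
    sub_self]

theorem toList_injective {γ γ' : DyckLattice n} (h : γ.word.toList = γ'.word.toList) : γ = γ' :=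
  DyckLattice.ext (DyckWord.ext h)

/-- The Dyck path with a given word of steps. -/
def ofList (w : List DyckStep) (hw : w.length = 2 * n) (hc : w.count U = w.count D)
    (hh : ∀ i, 0 ≤ pathHeight w i) : DyckLattice n where
  word := ⟨w, hc, fun i => by have := hh i; simp only [pathHeight] at this; omega⟩
  semilength_eq := by
    have := DyckWord.two_mul_semilength_eq_length
      (p := ⟨w, hc, fun i => by have := hh i; simp only [pathHeight] at this; omega⟩)
    simp only [hw] at this
    omega

/-- The number of peaks of a Dyck path. -/
def peaks (γ : DyckLattice n) : ℕ := factorCount U D γ.word.toList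

/-- The number of valleys of a Dyck path. -/
def valleys (γ : DyckLattice n) : ℕ := factorCount D U γ.word.toList

theorem peaks_le (γ : DyckLattice n) : γ.peaks ≤ 2 * n :=
  (factorCount_le_length _ _ _).trans γ.length_word.le

theorem valleys_le_peaks_add_one (γ : DyckLattice n) : γ.valleys ≤ γ.peaks + 1 :=
  _root_.valleys_le_peaks_add_one _

theorem peaks_le_valleys_add_one (γ : DyckLattice n) : γ.peaks ≤ γ.valleys + 1 :=
  _root_.peaks_le_valleys_add_one _

/-! ### Covers -/

/-- The Dyck path obtained by turning a valley into a peak. -/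
def flip (γ : DyckLattice n) (i : ℕ) (h : i ∈ factorPositions D U γ.word.toList) :
    DyckLattice n :=
  ofList (γ.word.toList.take i ++ U :: D :: γ.word.toList.drop (i + 2))
    (by
      have h1 := congrArg List.length (eq_take_append_of_mem_factorPositions h)
      rw [length_word] at h1
      rw [h1]
      simp)
    (by
      have h1 := congrArg (List.count U) (eq_take_append_of_mem_factorPositions h)
      have h2 := congrArg (List.count D) (eq_take_append_of_mem_factorPositions h)
      have h3 := γ.word.count_U_eq_count_D
      simp at h1 h2 ⊢
      omega)
    (fun j => by
      have h1 := γ.height_nonneg j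
      rw [height, eq_take_append_of_mem_factorPositions h] at h1
      rw [pathHeight_flip]
      split_ifs <;> omega)

theorem toList_flip (γ : DyckLattice n) (i : ℕ) (h : i ∈ factorPositions D U γ.word.toList) :
    (γ.flip i h).word.toList =
      γ.word.toList.take i ++ U :: D :: γ.word.toList.drop (i + 2) := rfl

theorem height_flip (γ : DyckLattice n) (i : ℕ) (h : i ∈ factorPositions D U γ.word.toList)
    (j : ℕ) : (γ.flip i h).height j = γ.height j + if j = i + 1 then 2 else 0 := by
  have hi : i ≤ γ.word.toList.length :=
    (List.getElem?_eq_some_iff.mp (mem_factorPositions.mp h).1).1.le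
  rw [height, toList_flip, pathHeight_flip, ← eq_take_append_of_mem_factorPositions h,
    List.length_take_of_le hi, height]

/-- Paths that differ at an abscissa differ there by at least 2, the amount of one flip. -/
theorem even_height_sub (γ γ' : DyckLattice n) (i : ℕ) : Even (γ'.height i - γ.height i) := by
  rcases le_total (2 * n) i with h | h
  · rw [height_eq_zero _ h, height_eq_zero _ h, sub_self]
    exact Even.zero
  · have h1 := even_pathHeight_add (w := γ.word.toList) (i := i) (by rwa [length_word])
    have h2 := even_pathHeight_add (w := γ'.word.toList) (i := i) (by rwa [length_word])
    have h3 := h2.sub h1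
    rwa [add_sub_add_right_eq_sub] at h3

theorem lt_flip (γ : DyckLattice n) (i : ℕ) (h : i ∈ factorPositions D U γ.word.toList) :
    γ < γ.flip i h := by
  refine lt_of_le_of_ne (fun j => ?_) fun e => ?_
  · rw [height_flip]
    split_ifs <;> omega
  · have h1 := height_flip γ i h (i + 1)
    rw [← e] at h1
    simp at h1

theorem covBy_flip (γ : DyckLattice n) (i : ℕ) (h : i ∈ factorPositions D U γ.word.toList) :
    γ ⋖ γ.flip i h := by
  refine ⟨γ.lt_flip i h, fun δ h1 h2 => ?_⟩
  have l1 := h1.le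
  have l2 := h2.le
  have ev := even_height_sub γ δ (i + 1)
  have m1 := l1 (i + 1)
  have m2 := l2 (i + 1)
  rw [height_flip, if_pos rfl] at m2
  obtain ⟨k, hk⟩ := ev
  have hne (j : ℕ) (hj : j ≠ i + 1) : δ.height j = γ.height j := by
    have m1 := l1 j
    have m2 := l2 j
    rw [height_flip, if_neg hj] at m2
    omega
  -- By parity the intermediate path is at one end or the other at `i + 1`, and it agrees with both
  -- elsewhere.
  rcases (by omega : k = 0 ∨ k = 1) with rfl | rfl
  · refine h1.ne (height_injective fun j => ?_)
    rcases eq_or_ne j (i + 1) with rfl | hj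
    · omega
    · exact (hne j hj).symm
  · refine h2.ne (height_injective fun j => ?_)
    rw [height_flip]
    split_ifs with hj
    · subst hj
      omega
    · rw [hne j hj, add_zero]

/-- Among the points of `γ` strictly below `γ'`, take one of least height. A lower neighbour would
also be strictly below `γ'`, so this point is a valley, and parity leaves room to raise it by 2. -/
theorem exists_flip_le {γ γ' : DyckLattice n} (hlt : γ < γ') :
    ∃ i h, γ.flip i h ≤ γ' := by
  classical
  have hle := hlt.le
  have hex : ∃ m : ℕ, ∃ i, γ.height i < γ'.height i ∧ γ.height i = m := by
    by_contra! hcon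
    refine hlt.ne (height_injective fun i => le_antisymm (hle i) ?_)
    by_contra! hi
    exact hcon (γ.height i).toNat i hi (Int.toNat_of_nonneg (γ.height_nonneg i)).symm
  obtain ⟨i, hi, hm⟩ := Nat.find_spec hex
  have hmin (j : ℕ) (hj : γ.height j < γ.height i) : ¬ γ.height j < γ'.height j := fun hlt' =>
    Nat.find_min hex (m := (γ.height j).toNat)
      (by have := γ.height_nonneg j; omega)
      ⟨j, hlt', (Int.toNat_of_nonneg (γ.height_nonneg j)).symm⟩
  have hi2 : i < 2 * n := by
    by_contra! h
    rw [height_eq_zero _ h, height_eq_zero _ h] at hi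
    exact lt_irrefl _ hi
  obtain _ | i := i
  · simp [height] at hi
  obtain ⟨k, hk⟩ := even_height_sub γ γ' (i + 1)
  have h1 : γ.word.toList[i]? = some D := by
    rw [List.getElem?_eq_getElem (by rw [length_word]; omega)]
    rcases DyckStep.dichotomy (γ.word.toList[i]'(by rw [length_word]; omega)) with h | h
    · exfalso
      have hs := pathHeight_succ_of_getElem? (w := γ.word.toList) (i := i) (a := U)
        (by rw [List.getElem?_eq_getElem (by rw [length_word]; omega), h])
      have hs' := pathHeight_succ_le_add_one γ'.word.toList i
      simp only [rise_U] at hs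
      simp only [height] at hi hmin hk hle
      have hl := hle i
      exact hmin i (by omega) (by omega)
    · rw [h]
  have h2 : γ.word.toList[i + 1]? = some U := by
    rw [List.getElem?_eq_getElem (by rw [length_word]; omega)]
    rcases DyckStep.dichotomy (γ.word.toList[i + 1]'(by rw [length_word]; omega)) with h | h
    · rw [h]
    · exfalso
      have hs := pathHeight_succ_of_getElem? (w := γ.word.toList) (i := i + 1) (a := D)
        (by rw [List.getElem?_eq_getElem (by rw [length_word]; omega), h])
      have hs' := sub_one_le_pathHeight_succ γ'.word.toList (i + 1)
      simp only [rise_D] at hs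
      simp only [height] at hi hmin hk hle
      have hl := hle (i + 1 + 1)
      exact hmin (i + 1 + 1) (by omega) (by omega)
  refine ⟨i, mem_factorPositions.mpr ⟨h1, h2⟩, fun j => ?_⟩
  rw [height_flip]
  split_ifs with hj
  · subst hj
    omega
  · simpa using hle j

theorem covBy_iff_exists_flip {γ γ' : DyckLattice n} : γ ⋖ γ' ↔ ∃ i h, γ.flip i h = γ' := by
  constructor
  · intro hc
    obtain ⟨i, h, hle⟩ := exists_flip_le hc.lt
    exact ⟨i, h, hle.eq_of_not_lt fun hlt => hc.2 (γ.lt_flip i h) hlt⟩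
  · rintro ⟨i, h, rfl⟩
    exact γ.covBy_flip i h

theorem valleys_of_covBy {γ γ' : DyckLattice n} (h : γ ⋖ γ') :
    γ'.valleys ≤ γ.valleys + 1 ∧ γ.valleys ≤ γ'.valleys + 1 := by
  obtain ⟨i, hi, rfl⟩ := covBy_iff_exists_flip.mp h
  have := valleys_flip (γ.word.toList.take i) (γ.word.toList.drop (i + 2))
  rwa [← eq_take_append_of_mem_factorPositions hi, ← toList_flip γ i hi] at this

/-- The abscissa at which the height rises recovers the flipped valley. -/
theorem card_covers (γ : DyckLattice n) : Nat.card { γ' // γ ⋖ γ' } = γ.valleys := by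
  rw [valleys, factorCount, ← Nat.card_eq_finsetCard]
  refine (Nat.card_congr (Equiv.ofBijective
    (fun i : factorPositions D U γ.word.toList =>
      (⟨γ.flip i.1 i.2, γ.covBy_flip i.1 i.2⟩ : { γ' // γ ⋖ γ' })) ⟨?_, ?_⟩)).symm
  · intro i j hij
    have h1 := congrArg (fun δ => δ.1.height (i.1 + 1)) hij
    simp only [height_flip, if_true] at h1
    split_ifs at h1 with h
    · exact Subtype.ext (by omega)
    · omega
  · rintro ⟨γ', h⟩
    obtain ⟨i, hi, rfl⟩ := covBy_iff_exists_flip.mp h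
    exact ⟨⟨i, hi⟩, rfl⟩

/-! ### Insertion of a peak -/

/-- The Dyck path obtained by inserting a peak after the first `i` steps. -/
def insertPeak (γ : DyckLattice n) (i : ℕ) : DyckLattice (n + 1) :=
  ofList (γ.word.toList.take i ++ U :: D :: γ.word.toList.drop i)
    (by
      have h1 := congrArg List.length (List.take_append_drop i γ.word.toList)
      rw [length_word, List.length_append] at h1
      simp only [List.length_append, List.length_cons]
      omega)
    (by
      have h1 := congrArg (List.count U) (List.take_append_drop i γ.word.toList)
      have h2 := congrArg (List.count D) (List.take_append_drop i γ.word.toList)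
      have h3 := γ.word.count_U_eq_count_D
      simp only [List.count_append] at h1 h2
      simp
      omega)
    (by
      have h1 := (forall_nonneg_pathHeight_insert (γ.word.toList.take i)
        (γ.word.toList.drop i) 0).mpr
      simp only [zero_add, List.take_append_drop] at h1
      exact h1 γ.height_nonneg)

theorem toList_insertPeak (γ : DyckLattice n) (i : ℕ) :
    (γ.insertPeak i).word.toList = γ.word.toList.take i ++ U :: D :: γ.word.toList.drop i := rfl

theorem peaks_insertPeak (γ : DyckLattice n) (i : ℕ) :
    γ.peaks ≤ (γ.insertPeak i).peaks ∧ (γ.insertPeak i).peaks ≤ γ.peaks + 1 := by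
  have := peaks_insert (γ.word.toList.take i) (γ.word.toList.drop i)
  rwa [List.take_append_drop, ← toList_insertPeak] at this

theorem exists_insertPeak_eq (γ : DyckLattice (n + 1)) {i : ℕ}
    (h : i ∈ factorPositions U D γ.word.toList) :
    i < 2 * n + 1 ∧ ∃ δ : DyckLattice n, δ.insertPeak i = γ := by
  have hi := (List.getElem?_eq_some_iff.mp (mem_factorPositions.mp h).2).1
  rw [length_word] at hi
  have e := eq_take_append_of_mem_factorPositions h
  set L := γ.word.toList.take i with hL
  set R := γ.word.toList.drop (i + 2)
  have hLi : L.length = i := List.length_take_of_le (by rw [length_word]; omega)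
  refine ⟨by omega, ofList (L ++ R) ?_ ?_ ?_, toList_injective ?_⟩
  · have h1 := γ.length_word
    rw [e] at h1
    simp only [List.length_append, List.length_cons] at h1 ⊢
    omega
  · have h1 := γ.word.count_U_eq_count_D
    rw [e] at h1
    simp at h1 ⊢
    omega
  · have h1 := (forall_nonneg_pathHeight_insert L R 0).mp
    simp only [zero_add, ← e] at h1
    exact h1 γ.height_nonneg
  · refine Eq.trans ?_ e.symm
    change (L ++ R).take i ++ U :: D :: (L ++ R).drop i = _
    rw [← hLi, List.take_left, List.drop_left]

/-- Double counting of paths with a marked peak: deleting it leaves a shorter path and the place of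
insertion. -/
theorem sum_peaks_mul (n : ℕ) (f : DyckLattice (n + 1) → ℕ) :
    ∑ γ, γ.peaks * f γ =
      ∑ γ : DyckLattice n, ∑ i ∈ Finset.range (2 * n + 1), f (γ.insertPeak i) := by
  have h (γ : DyckLattice (n + 1)) :
      γ.peaks * f γ = ∑ _i ∈ factorPositions U D γ.word.toList, f γ := by
    rw [Finset.sum_const, smul_eq_mul, peaks, factorCount]
  simp only [h]
  rw [Finset.sum_sigma', Finset.sum_sigma']
  symm
  refine Finset.sum_bij (fun x _ => ⟨x.1.insertPeak x.2, x.2⟩) ?_ ?_ ?_ (fun _ _ => rfl)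
  · rintro ⟨γ, i⟩ hx
    simp only [Finset.mem_sigma, Finset.mem_univ, Finset.mem_range, true_and] at hx ⊢
    have hl : (γ.word.toList.take i).length = i :=
      List.length_take_of_le (by rw [length_word]; omega)
    rw [mem_factorPositions, toList_insertPeak, List.getElem?_append_right (by omega),
      List.getElem?_append_right (by omega), hl]
    simp
  · rintro ⟨γ, i⟩ hx ⟨γ', j⟩ hy hxy
    simp only [Sigma.mk.injEq, heq_eq_eq] at hxy
    obtain ⟨h1, rfl⟩ := hxy
    simp only [Finset.mem_sigma, Finset.mem_univ, Finset.mem_range, true_and] at hx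
    have h2 : γ.word.toList.take i ++ U :: D :: γ.word.toList.drop i =
        γ'.word.toList.take i ++ U :: D :: γ'.word.toList.drop i :=
      congrArg (fun δ => δ.word.toList) h1
    obtain ⟨h3, h4⟩ := List.append_inj h2 (by simp [length_word])
    simp only [List.cons.injEq, true_and] at h4
    have h5 : γ = γ' := toList_injective (by
      rw [← List.take_append_drop i γ.word.toList, h3, h4, List.take_append_drop])
    rw [h5]
  · rintro ⟨γ, i⟩ hx
    simp only [Finset.mem_sigma, Finset.mem_univ, true_and] at hx
    obtain ⟨hi, δ, rfl⟩ := exists_insertPeak_eq γ hx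
    exact ⟨⟨δ, i⟩, by simpa using hi, rfl⟩

theorem le_sum_peaks_mul (n : ℕ) {f : ℕ → ℕ} (hf : Monotone f) :
    (2 * n + 1) * ∑ γ : DyckLattice n, f γ.peaks ≤
      ∑ γ : DyckLattice (n + 1), γ.peaks * f γ.peaks := by
  rw [sum_peaks_mul, Finset.mul_sum]
  refine Finset.sum_le_sum fun γ _ => ?_
  refine le_trans (by simp) (Finset.card_nsmul_le_sum (Finset.range (2 * n + 1)) _ (f γ.peaks)
    fun i _ => hf (γ.peaks_insertPeak i).1)

theorem sum_peaks_mul_le (n : ℕ) {f : ℕ → ℕ} (hf : Monotone f) :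
    ∑ γ : DyckLattice (n + 1), γ.peaks * f γ.peaks ≤
      (2 * n + 1) * ∑ γ : DyckLattice n, f (γ.peaks + 1) := by
  rw [sum_peaks_mul, Finset.mul_sum]
  refine Finset.sum_le_sum fun γ _ => ?_
  refine le_trans (Finset.sum_le_card_nsmul (Finset.range (2 * n + 1)) _ (f (γ.peaks + 1))
    fun i _ => hf (γ.peaks_insertPeak i).2) (by simp)

end DyckLattice

/-! ### Counting 3-chains from a given path -/

theorem Nat.card_sigma_le_mul {α : Type*} {β : α → Type*} [Finite α] [∀ a, Finite (β a)] {k : ℕ}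
    (h : ∀ a, Nat.card (β a) ≤ k) : Nat.card (Σ a, β a) ≤ Nat.card α * k := by
  have := Fintype.ofFinite α
  rw [Nat.card_sigma, Nat.card_eq_fintype_card]
  exact Finset.sum_le_card_nsmul _ _ _ fun a _ => h a

theorem Nat.mul_le_card_sigma {α : Type*} {β : α → Type*} [Finite α] [∀ a, Finite (β a)] {k : ℕ}
    (h : ∀ a, k ≤ Nat.card (β a)) : Nat.card α * k ≤ Nat.card (Σ a, β a) := by
  have := Fintype.ofFinite α
  rw [Nat.card_sigma, Nat.card_eq_fintype_card]
  exact Finset.card_nsmul_le_sum _ _ _ fun a _ => h a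

/-- The saturated chains of length 3 which start at `a`, without `a` itself. -/
abbrev SaturatedThreeChainFrom {P : Type*} [PartialOrder P] (a : P) : Type _ :=
  Σ b : { b // a ⋖ b }, Σ c : { c // b.1 ⋖ c }, { d // c.1 ⋖ d }

/-- A saturated chain of length 3 is determined by its first element and the rest. -/
def saturatedChainThreeEquiv (P : Type*) [PartialOrder P] :
    SaturatedChain 3 P ≃ Σ a : P, SaturatedThreeChainFrom a where
  toFun s := ⟨s.1 0, ⟨s.1 1, s.2 0⟩, ⟨s.1 2, s.2 1⟩, ⟨s.1 3, s.2 2⟩⟩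
  invFun x := ⟨![x.1, x.2.1.1, x.2.2.1.1, x.2.2.2.1], fun i => by
    fin_cases i
    · exact x.2.1.2
    · exact x.2.2.1.2
    · exact x.2.2.2.2⟩
  left_inv s := by
    apply Subtype.ext
    funext i
    fin_cases i <;> rfl
  right_inv _ := rfl

/-- Converts the factor `2n+1` of the peak recursion into a ratio of Catalan numbers. -/
theorem succ_succ_mul_catalan_succ (n : ℕ) :
    (n + 2) * catalan (n + 1) = 2 * (2 * n + 1) * catalan n := by
  have h1 := Nat.succ_mul_centralBinom_succ n
  rw [← succ_mul_catalan_eq_centralBinom, ← succ_mul_catalan_eq_centralBinom] at h1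
  refine Nat.eq_of_mul_eq_mul_left n.succ_pos ?_
  rw [Nat.succ_eq_add_one]
  linarith

namespace DyckLattice

variable {n : ℕ}

theorem card_saturatedThreeChainFrom_le (γ : DyckLattice n) :
    Nat.card (SaturatedThreeChainFrom γ) ≤ γ.valleys * ((γ.valleys + 1) * (γ.valleys + 2)) := by
  rw [← card_covers γ]
  refine Nat.card_sigma_le_mul fun b => ?_
  have hb := (valleys_of_covBy b.2).1
  rw [card_covers γ]
  refine le_trans (Nat.card_sigma_le_mul (k := γ.valleys + 2) fun c => ?_) ?_
  · have hc := (valleys_of_covBy c.2).1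
    rw [card_covers]
    omega
  · rw [card_covers]
    gcongr

/-- Each cover loses at most one valley. Truncated subtraction makes the bound 0 when there are
fewer than three. -/
theorem le_card_saturatedThreeChainFrom (γ : DyckLattice n) :
    γ.valleys * ((γ.valleys - 1) * (γ.valleys - 2)) ≤ Nat.card (SaturatedThreeChainFrom γ) := by
  rw [← card_covers γ]
  refine Nat.mul_le_card_sigma fun b => ?_
  have hb := (valleys_of_covBy b.2).2
  rw [card_covers γ]
  refine le_trans ?_ (Nat.mul_le_card_sigma (k := γ.valleys - 2) fun c => ?_)
  · rw [card_covers]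
    gcongr
    omega
  · have hc := (valleys_of_covBy c.2).2
    rw [card_covers]
    omega

/-- `(p+1)(p+2)(p+3)` exceeds `p(p-1)(p-2)` by `9p²+9p+6`, and `p ≤ 2n`. The falling product is the
one whose sum the recursion bounds above; the rising product plays this role below. -/
theorem card_saturatedThreeChainFrom_le_peaks (γ : DyckLattice n) :
    Nat.card (SaturatedThreeChainFrom γ) ≤
      γ.peaks * ((γ.peaks - 1) * (γ.peaks - 2)) + 60 * (n + 1) ^ 2 := by
  have h0 := γ.card_saturatedThreeChainFrom_le
  have h1 := γ.valleys_le_peaks_add_one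
  have h2 := γ.peaks_le
  generalize Nat.card (SaturatedThreeChainFrom γ) = t at *
  generalize γ.valleys = v at *
  generalize γ.peaks = p at *
  have h3 : v * ((v + 1) * (v + 2)) ≤ (p + 1) * ((p + 1 + 1) * (p + 1 + 2)) := by gcongr
  refine (h0.trans h3).trans ?_
  obtain _ | _ | q := p
  · nlinarith
  · nlinarith
  · simp only [add_tsub_cancel_right, add_assoc, Nat.reduceAdd] at *
    have : q + 2 - 1 = q + 1 := rfl
    rw [this]
    nlinarith

theorem peaks_le_card_saturatedThreeChainFrom (γ : DyckLattice n) :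
    γ.peaks * ((γ.peaks + 1) * (γ.peaks + 2)) ≤
      Nat.card (SaturatedThreeChainFrom γ) + 60 * (n + 1) ^ 2 := by
  have h0 := γ.le_card_saturatedThreeChainFrom
  have h1 := γ.peaks_le_valleys_add_one
  have h2 := γ.peaks_le
  have h4 := γ.valleys_le_peaks_add_one
  generalize Nat.card (SaturatedThreeChainFrom γ) = t at *
  generalize γ.valleys = v at *
  generalize γ.peaks = p at *
  have h3 : p * ((p + 1) * (p + 2)) ≤ (v + 1) * ((v + 1 + 1) * (v + 1 + 2)) := by gcongr
  refine h3.trans (le_trans ?_ (Nat.add_le_add_right h0 _))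
  obtain _ | _ | q := v
  · nlinarith
  · nlinarith
  · simp only [add_tsub_cancel_right, add_assoc, Nat.reduceAdd] at *
    have : q + 2 - 1 = q + 1 := rfl
    rw [this]
    have : q + 1 ≤ 2 * n := by omega
    nlinarith

theorem numSaturatedChains_three (n : ℕ) :
    numSaturatedChains 3 (DyckLattice n) =
      ∑ γ : DyckLattice n, Nat.card (SaturatedThreeChainFrom γ) := by
  rw [numSaturatedChains, Nat.card_congr (saturatedChainThreeEquiv _), Nat.card_sigma]

/-! ### Moments of the number of peaks -/

theorem le_sum_peaks (n : ℕ) :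
    (n + 2) * catalan (n + 1) ≤ 2 * ∑ γ : DyckLattice (n + 1), γ.peaks := by
  have h := le_sum_peaks_mul n (f := fun _ => 1) monotone_const
  simp only [mul_one, Finset.sum_const, Finset.card_univ, card_eq_catalan, smul_eq_mul] at h
  rw [succ_succ_mul_catalan_succ]
  linarith

theorem sum_peaks_le (n : ℕ) :
    2 * ∑ γ : DyckLattice (n + 1), γ.peaks ≤ (n + 2) * catalan (n + 1) := by
  have h := sum_peaks_mul_le n (f := fun _ => 1) monotone_const
  simp only [mul_one, Finset.sum_const, Finset.card_univ, card_eq_catalan, smul_eq_mul] at h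
  rw [succ_succ_mul_catalan_succ]
  linarith

theorem le_sum_peaks_two (n : ℕ) :
    (n + 2) * (n + 3) * catalan (n + 2) ≤
      4 * ∑ γ : DyckLattice (n + 2), γ.peaks * (γ.peaks + 1) := by
  have h := le_sum_peaks_mul (n + 1) (f := fun p => p + 1)
    (fun _ _ h => by dsimp only; gcongr)
  have h1 : ∑ γ : DyckLattice (n + 1), γ.peaks ≤ ∑ γ : DyckLattice (n + 1), (γ.peaks + 1) :=
    Finset.sum_le_sum fun _ _ => Nat.le_succ _
  calc (n + 2) * (n + 3) * catalan (n + 2)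
      = 2 * (2 * (n + 1) + 1) * ((n + 2) * catalan (n + 1)) := by
        linear_combination (n + 2) * succ_succ_mul_catalan_succ (n + 1)
    _ ≤ 2 * (2 * (n + 1) + 1) * (2 * ∑ γ : DyckLattice (n + 1), (γ.peaks + 1)) := by
        exact Nat.mul_le_mul_left _ ((le_sum_peaks n).trans (by gcongr))
    _ ≤ _ := by linarith

/-- With `f p = p - 1` the shift in `sum_peaks_mul_le` gives back `p`, the preceding moment. The
third moment uses the same telescoping. -/
theorem sum_peaks_two_le (n : ℕ) :
    4 * ∑ γ : DyckLattice (n + 2), γ.peaks * (γ.peaks - 1) ≤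
      (n + 2) * (n + 3) * catalan (n + 2) := by
  have h := sum_peaks_mul_le (n + 1) (f := fun p => p - 1)
    (fun _ _ h => by dsimp only; gcongr)
  simp only [add_tsub_cancel_right] at h
  calc _ ≤ 2 * (2 * (n + 1) + 1) * (2 * ∑ γ : DyckLattice (n + 1), γ.peaks) := by linarith
    _ ≤ 2 * (2 * (n + 1) + 1) * ((n + 2) * catalan (n + 1)) := by
        exact Nat.mul_le_mul_left _ (sum_peaks_le n)
    _ = _ := by linear_combination (n + 2) * (succ_succ_mul_catalan_succ (n + 1)).symm

theorem le_sum_peaks_three (n : ℕ) :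
    (n + 2) * (n + 3) * (n + 4) * catalan (n + 3) ≤
      8 * ∑ γ : DyckLattice (n + 3), γ.peaks * ((γ.peaks + 1) * (γ.peaks + 2)) := by
  have h := le_sum_peaks_mul (n + 2) (f := fun p => (p + 1) * (p + 2))
    (fun _ _ h => by dsimp only; gcongr)
  have h1 : ∑ γ : DyckLattice (n + 2), γ.peaks * (γ.peaks + 1) ≤
      ∑ γ : DyckLattice (n + 2), (γ.peaks + 1) * (γ.peaks + 2) :=
    Finset.sum_le_sum fun _ _ => by gcongr <;> omega
  calc (n + 2) * (n + 3) * (n + 4) * catalan (n + 3)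
      = 2 * (2 * (n + 2) + 1) * ((n + 2) * (n + 3) * catalan (n + 2)) := by
        linear_combination (n + 2) * (n + 3) * succ_succ_mul_catalan_succ (n + 2)
    _ ≤ 2 * (2 * (n + 2) + 1) *
          (4 * ∑ γ : DyckLattice (n + 2), (γ.peaks + 1) * (γ.peaks + 2)) := by
        exact Nat.mul_le_mul_left _ ((le_sum_peaks_two n).trans (by gcongr))
    _ ≤ _ := by linarith

theorem sum_peaks_three_le (n : ℕ) :
    8 * ∑ γ : DyckLattice (n + 3), γ.peaks * ((γ.peaks - 1) * (γ.peaks - 2)) ≤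
      (n + 2) * (n + 3) * (n + 4) * catalan (n + 3) := by
  have h := sum_peaks_mul_le (n + 2) (f := fun p => (p - 1) * (p - 2))
    (fun _ _ h => by dsimp only; gcongr)
  have h2 (p : ℕ) : p + 1 - 2 = p - 1 := rfl
  simp only [add_tsub_cancel_right, h2] at h
  calc _ ≤ 2 * (2 * (n + 2) + 1) *
          (4 * ∑ γ : DyckLattice (n + 2), γ.peaks * (γ.peaks - 1)) := by linarith
    _ ≤ 2 * (2 * (n + 2) + 1) * ((n + 2) * (n + 3) * catalan (n + 2)) := by
        exact Nat.mul_le_mul_left _ (sum_peaks_two_le n)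
    _ = _ := by linear_combination (n + 2) * (n + 3) * (succ_succ_mul_catalan_succ (n + 2)).symm

theorem catalan_pos (n : ℕ) : 0 < catalan n :=
  Nat.pos_of_mul_pos_left (a := n + 1)
    ((succ_mul_catalan_eq_centralBinom n).symm ▸ n.centralBinom_pos)

theorem hasseIndex_three_eq (n : ℕ) :
    hasseIndex 3 (DyckLattice n) = numSaturatedChains 3 (DyckLattice n) / catalan n := by
  rw [hasseIndex, Nat.card_eq_fintype_card, card_eq_catalan]

theorem abs_hasseIndex_three_sub_le (n : ℕ) :
    |hasseIndex 3 (DyckLattice (n + 3)) - (n + 2) * (n + 3) * (n + 4) / 8| ≤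
      60 * ((n : ℝ) + 4) ^ 2 := by
  have hc : (0 : ℝ) < catalan (n + 3) := by exact_mod_cast catalan_pos (n + 3)
  -- The constant is `480 = 8 * 60`: the error per path, summed over all `catalan (n + 3)` paths.
  have h1 : 8 * numSaturatedChains 3 (DyckLattice (n + 3)) ≤
      (n + 2) * (n + 3) * (n + 4) * catalan (n + 3) +
        480 * (n + 4) ^ 2 * catalan (n + 3) := by
    have h := Finset.sum_le_sum fun γ (_ : γ ∈ (Finset.univ : Finset (DyckLattice (n + 3)))) =>
      card_saturatedThreeChainFrom_le_peaks γ
    rw [Finset.sum_add_distrib, Finset.sum_const, Finset.card_univ, card_eq_catalan,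
      ← numSaturatedChains_three, smul_eq_mul] at h
    have := sum_peaks_three_le n
    linarith
  have h2 : (n + 2) * (n + 3) * (n + 4) * catalan (n + 3) ≤
      8 * numSaturatedChains 3 (DyckLattice (n + 3)) +
        480 * (n + 4) ^ 2 * catalan (n + 3) := by
    have h := Finset.sum_le_sum fun γ (_ : γ ∈ (Finset.univ : Finset (DyckLattice (n + 3)))) =>
      peaks_le_card_saturatedThreeChainFrom γ
    rw [Finset.sum_add_distrib, Finset.sum_const, Finset.card_univ, card_eq_catalan,
      ← numSaturatedChains_three, smul_eq_mul] at h
    have := le_sum_peaks_three n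
    linarith
  have h1' : (8 * numSaturatedChains 3 (DyckLattice (n + 3)) : ℝ) ≤
      (n + 2) * (n + 3) * (n + 4) * catalan (n + 3) +
        480 * (n + 4) ^ 2 * catalan (n + 3) := by exact_mod_cast h1
  have h2' : ((n + 2) * (n + 3) * (n + 4) * catalan (n + 3) : ℝ) ≤
      8 * numSaturatedChains 3 (DyckLattice (n + 3)) +
        480 * (n + 4) ^ 2 * catalan (n + 3) := by exact_mod_cast h2
  rw [hasseIndex_three_eq, abs_le, neg_le_sub_iff_le_add, sub_le_iff_le_add, div_le_iff₀ hc,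
    ← sub_le_iff_le_add, le_div_iff₀ hc]
  constructor <;> linarith

end DyckLattice

/-! ### Asymptotics -/

theorem isEquivalent_cube_div_of_abs_sub_le {u : ℕ → ℝ} {C : ℝ}
    (h : ∀ᶠ n : ℕ in atTop, |u n - (n : ℝ) ^ 3 / 8| ≤ C * (n : ℝ) ^ 2) :
    u ~[atTop] fun n : ℕ => (n : ℝ) ^ 3 / 8 := by
  have h1 : (u - fun n : ℕ => (n : ℝ) ^ 3 / 8) =O[atTop] fun n : ℕ => (n : ℝ) ^ 2 := by
    refine IsBigO.of_bound C ?_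
    filter_upwards [h] with n hn
    rw [Pi.sub_apply, Real.norm_eq_abs, Real.norm_of_nonneg (by positivity)]
    exact hn
  have h2 : (fun n : ℕ => (n : ℝ) ^ 2) =o[atTop] fun n : ℕ => (n : ℝ) ^ 3 :=
    (isLittleO_pow_pow_atTop_of_lt (𝕜 := ℝ) (by norm_num : 2 < 3)).comp_tendsto
      tendsto_natCast_atTop_atTop
  have h3 : (fun n : ℕ => (n : ℝ) ^ 3) =O[atTop] fun n : ℕ => (n : ℝ) ^ 3 / 8 := by
    refine IsBigO.of_bound 8 (Eventually.of_forall fun n => ?_)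
    rw [norm_div, Real.norm_of_nonneg (by norm_num : (0 : ℝ) ≤ 8), mul_div_cancel₀ _ (by norm_num)]
  exact h1.trans_isLittleO (h2.trans_isBigO h3)

theorem hasseIndex_three_isEquivalent :
    (fun n : ℕ => hasseIndex 3 (DyckLattice n)) ~[atTop] fun n : ℕ => (n : ℝ) ^ 3 / 8 := by
  -- A generous constant: it absorbs `60(n+1)²` and the gap `n/8` between `n³/8` and
  -- `(n-1)n(n+1)/8`.
  refine isEquivalent_cube_div_of_abs_sub_le (C := 300) ?_
  filter_upwards [eventually_ge_atTop 3] with n hn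
  obtain ⟨m, rfl⟩ := Nat.exists_eq_add_of_le' hn
  have h := DyckLattice.abs_hasseIndex_three_sub_le m
  rw [abs_le] at h ⊢
  push_cast
  have hm : (0 : ℝ) ≤ m := m.cast_nonneg
  constructor <;> nlinarith

theorem descFactorial_three_div_isEquivalent :
    (fun n : ℕ => (n.descFactorial 3 : ℝ) / (2 : ℝ) ^ 3) ~[atTop]
      fun n : ℕ => (n : ℝ) ^ 3 / 8 := by
  refine isEquivalent_cube_div_of_abs_sub_le (C := 1) ?_
  filter_upwards [eventually_ge_atTop 2] with n hn
  obtain ⟨m, rfl⟩ := Nat.exists_eq_add_of_le' hn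
  have h : (m + 2).descFactorial 3 = (m + 2) * (m + 1) * m := by
    simp [Nat.descFactorial]
    ring
  rw [h, abs_le]
  push_cast
  have hm : (0 : ℝ) ≤ m := m.cast_nonneg
  constructor <;> nlinarith

/-- Stirling's formula applied to `(2n)!/(n!)²`; the powers of `n/e` cancel. -/
theorem centralBinom_isEquivalent :
    (fun n : ℕ => (n.centralBinom : ℝ)) ~[atTop]
      fun n : ℕ => (4 : ℝ) ^ n / Real.sqrt (Real.pi * n) := by
  have h1 := Stirling.factorial_isEquivalent_stirling
  have h2 : Tendsto (fun n : ℕ => 2 * n) atTop atTop :=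
    tendsto_id.const_mul_atTop' (by norm_num)
  have h3 := (h1.comp_tendsto h2).div (h1.mul h1)
  refine (h3.congr_left ?_).congr_right ?_
  · refine Eventually.of_forall fun n => ?_
    simp only [Pi.div_apply, Pi.mul_apply, Function.comp_apply]
    rw [Nat.centralBinom_eq_two_mul_choose, Nat.cast_choose ℝ (by omega : n ≤ 2 * n)]
    congr 3
    rw [two_mul, Nat.add_sub_cancel]
  · filter_upwards [eventually_gt_atTop 0] with n hn
    have hn' : (0 : ℝ) < n := by exact_mod_cast hn
    simp only [Pi.div_apply, Pi.mul_apply, Function.comp_apply, Nat.cast_mul, Nat.cast_ofNat]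
    have e1 : Real.sqrt (2 * (2 * n) * Real.pi) = 2 * Real.sqrt (Real.pi * n) := by
      rw [show (2 * (2 * n) * Real.pi : ℝ) = 2 ^ 2 * (Real.pi * n) by ring,
        Real.sqrt_mul (by positivity), Real.sqrt_sq (by norm_num)]
    have e2 : Real.sqrt (2 * n * Real.pi) * Real.sqrt (2 * n * Real.pi) =
        2 * (Real.sqrt (Real.pi * n) * Real.sqrt (Real.pi * n)) := by
      rw [Real.mul_self_sqrt (by positivity), Real.mul_self_sqrt (by positivity)]
      ring
    have e3 : (2 * n / Real.exp 1) ^ (2 * n) =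
        (4 : ℝ) ^ n * ((n / Real.exp 1) ^ n * (n / Real.exp 1) ^ n) := by
      rw [pow_mul, ← mul_pow, ← mul_pow]
      ring
    rw [e1, e3, mul_mul_mul_comm (Real.sqrt (2 * n * Real.pi)), e2]
    have : 0 < Real.sqrt (Real.pi * n) := Real.sqrt_pos.mpr (by positivity)
    have : (0 : ℝ) < (n / Real.exp 1) ^ n := by positivity
    generalize (n / Real.exp 1) ^ n = x at *
    field_simp

theorem catalan_isEquivalent :
    (fun n : ℕ => (catalan n : ℝ)) ~[atTop]
      fun n : ℕ => (4 : ℝ) ^ n / Real.sqrt (Real.pi * n) / n := by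
  have h : (fun n : ℕ => ((n : ℝ) + 1)) ~[atTop] fun n : ℕ => (n : ℝ) :=
    IsEquivalent.refl.add_isLittleO
      ((isLittleO_const_id_atTop (1 : ℝ)).comp_tendsto tendsto_natCast_atTop_atTop)
  refine (centralBinom_isEquivalent.div h).congr_left (Eventually.of_forall fun n => ?_)
  have hn : (n : ℝ) + 1 ≠ 0 := by positivity
  rw [Pi.div_apply, ← succ_mul_catalan_eq_centralBinom, Nat.cast_mul, Nat.cast_succ,
    mul_div_cancel_left₀ _ hn]

theorem mainTheorem5 :
    HasseIndexAsymptoticallyBoolean 3 DyckLattice ∧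
    ((fun n : ℕ => hasseIndex 3 (DyckLattice n)) ~[atTop] fun n : ℕ => (n : ℝ) ^ 3 / 8) ∧
    ((fun n : ℕ => (numSaturatedChains 3 (DyckLattice n) : ℝ)) ~[atTop]
      fun n : ℕ => (2 : ℝ) ^ (2 * (n : ℝ) - 3) * (n : ℝ) ^ ((3 : ℝ) / 2) / Real.sqrt Real.pi) := by
  refine ⟨hasseIndex_three_isEquivalent.trans descFactorial_three_div_isEquivalent.symm,
    hasseIndex_three_isEquivalent, ?_⟩
  -- The number of chains is the Hasse index times `catalan n`.
  refine ((hasseIndex_three_isEquivalent.mul catalan_isEquivalent).congr_left ?_).congr_right ?_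
  · refine Eventually.of_forall fun n => ?_
    have hc : (catalan n : ℝ) ≠ 0 := by exact_mod_cast (DyckLattice.catalan_pos n).ne'
    simp only [Pi.mul_apply]
    rw [DyckLattice.hasseIndex_three_eq, div_mul_cancel₀ _ hc]
  · filter_upwards [eventually_gt_atTop 0] with n hn
    have hn' : (0 : ℝ) < n := by exact_mod_cast hn
    have e1 : (2 : ℝ) ^ (2 * (n : ℝ) - 3) = 4 ^ n / 8 := by
      rw [Real.rpow_sub two_pos, Real.rpow_mul two_pos.le, Real.rpow_natCast]
      norm_num
    have e2 : (n : ℝ) ^ ((3 : ℝ) / 2) = n * Real.sqrt n := by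
      rw [show (3 : ℝ) / 2 = 1 + 1 / 2 by norm_num, Real.rpow_add hn', Real.rpow_one,
        Real.sqrt_eq_rpow]
    have hs : 0 < Real.sqrt n := Real.sqrt_pos.mpr hn'
    have hp : 0 < Real.sqrt Real.pi := Real.sqrt_pos.mpr Real.pi_pos
    have hsq : Real.sqrt n ^ 2 = n := Real.sq_sqrt hn'.le
    simp only [Pi.mul_apply]
    rw [e1, e2, Real.sqrt_mul Real.pi_pos.le]
    field_simp
    rw [hsq]
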